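/- Let $\alpha,\beta>0$, let $d\ge 1$ be an integer and let $1\le p\le\infty$ (with $1/p:=0$ if $p=\infty$). For a real function $f$ write $|f|_{\alpha,\beta}:=\alpha\max\{f,0\}+\beta\max\{-f,0\}$, let $Q(\mathbf x)=\sum_{j=1}^d x_j^2$, and for a nondegenerate ($d$-dimensional) solid simplex $\mathcal T\subset\mathbb R^d$ with $d$-dimensional volume $|\mathcal T|$ put $$E(\mathcal T):=\inf_{\mathbf a\in\mathbb R^d,\;c\in\mathbb R}\Big\|\,\Big|Q(\mathbf x)-\sum_{j=1}^d a_jx_j-c\Big|_{\alpha,\beta}\Big\|_{L_p(\mathcal T)},\qquad \sigma_{p;\alpha,\beta;d}(\mathcal T):=\frac{E(\mathcal T)}{|\mathcal T|^{\frac 2d+\frac 1p}},\qquad \sigma_{p;\alpha,\beta;d}:=\inf_{\mathcal T}\sigma_{p;\alpha,\beta;d}(\mathcal T),$$ where the last infimum is over all nondegenerate simplices $\mathcal T\subset\mathbb R^d$. If $\mathcal T_0$ is a regular simplex of unit volume in $\mathbb R^d$, then $$\sigma_{p;\alpha,\beta;d}=\sigma_{p;\alpha,\beta;d}(\mathcal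 T_0).$$ In particular, among the simplices of unit volume the error is minimized by the regular one: $\inf\{E(\mathcal T):|\mathcal T|=1\}=E(\mathcal T_0)$. -/

import Mathlib

open MeasureTheory
open scoped ENNReal

noncomputable section

/-- The asymmetric modulus `|t|_{α,β} = α t₊ + β t₋`, where `t₊ = max t 0`, `t₋ = max (-t) 0`. -/
def asymAbs (α β t : ℝ) : ℝ := α * max t 0 + β * max (-t) 0

/-- The asymmetric norm `‖f‖_{L_{p;α,β}(G)}`: the `L_p(G)`-norm of `|f|_{α,β}`
(the essential supremum over `G` for `p = ∞`), with values in `[0, ∞]`. -/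
def asymNorm {d : ℕ} (p : ℝ≥0∞) (α β : ℝ) (G : Set (EuclideanSpace ℝ (Fin d)))
    (f : EuclideanSpace ℝ (Fin d) → ℝ) : ℝ≥0∞ :=
  eLpNorm (fun x => asymAbs α β (f x)) p (volume.restrict G)

/-- The best `(α,β)`-approximation `E(f; H)_{L_{p;α,β}(G)}` of `f` by the set `H`. -/
def bestApprox {d : ℕ} (p : ℝ≥0∞) (α β : ℝ) (G : Set (EuclideanSpace ℝ (Fin d)))
    (f : EuclideanSpace ℝ (Fin d) → ℝ) (H : Set (EuclideanSpace ℝ (Fin d) → ℝ)) : ℝ≥0∞ :=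
  ⨅ u ∈ H, asymNorm p α β G (fun x => f x - u x)

/-- The affine functions `x ↦ a · x + c` on `ℝ^d`. -/
def affineFns (d : ℕ) : Set (EuclideanSpace ℝ (Fin d) → ℝ) :=
  {g | ∃ (a : EuclideanSpace ℝ (Fin d)) (c : ℝ), g = fun x => (∑ j, a j * x j) + c}

/-- The quadratic function `Q(x) = x₁² + ⋯ + x_d²`. -/
def quadQ (d : ℕ) (x : EuclideanSpace ℝ (Fin d)) : ℝ := ∑ j, x j ^ 2

/-- The error `E(Q; S₁(T))_{L_{p;α,β}(T)}` on the solid simplex `T`; the simplex is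
nondegenerate, since its `d + 1` vertices are affinely independent in `ℝ^d`. -/
def simplexError {d : ℕ} (p : ℝ≥0∞) (α β : ℝ)
    (T : Affine.Simplex ℝ (EuclideanSpace ℝ (Fin d)) d) : ℝ≥0∞ :=
  bestApprox p α β T.closedInterior (quadQ d) (affineFns d)

/-- The volume-normalized error `σ_{p;α,β;d}(T) = E(Q; S₁(T))_{L_{p;α,β}(T)} / |T|^{2/d + 1/p}`,
where `1/p = 0` for `p = ∞`. The exponent makes it invariant under dilations of `T`. -/
def simplexSigma {d : ℕ} (p : ℝ≥0∞) (α β : ℝ)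
    (T : Affine.Simplex ℝ (EuclideanSpace ℝ (Fin d)) d) : ℝ≥0∞ :=
  simplexError p α β T / (volume T.closedInterior) ^ (2 / (d : ℝ) + (p⁻¹).toReal)

/-- `σ_{p;α,β;d}`, the infimum of `σ_{p;α,β;d}(T)` over all simplices `T` in `ℝ^d`. -/
def sigmaInf (d : ℕ) (p : ℝ≥0∞) (α β : ℝ) : ℝ≥0∞ :=
  ⨅ T : Affine.Simplex ℝ (EuclideanSpace ℝ (Fin d)) d, simplexSigma p α β T

end

/-! ### Permutation averages, squared norms, AM–GM. -/

open scoped InnerProductSpace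

/-! Write `T` as the image of `T₀` under an affine map `e` with linear part `A`. Pulling back to
`T₀` turns `Q - u` into `Q ∘ e - u ∘ e` and costs a factor `|det A|^(1/p)`. Each symmetry of `T₀`
preserves the asymmetric norm, which is subadditive, so averaging over all of them cannot increase
the error. The average of `Q ∘ e` is `tr(AᵀA)/d` times `Q` plus an affine function
(`exists_affine_sum_perm_norm_sq`): modulo affine functions a quadratic form is determined by its
values on the edges, and averaging makes these equal. Finally `tr(AᵀA)/d ≥ |det A|^(2/d)` by AM–GM,
and `|det A| = |T|`. -/

/-- The symmetric group is 2-transitive, so the sum over `σ` is the same for every ordered pair of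
distinct indices. -/
theorem Equiv.Perm.sum_apply_pair {ι : Type*} [Fintype ι] [DecidableEq ι] (f : ι → ι → ℝ)
    (hf : ∀ i, f i i = 0) {i j : ι} (hij : i ≠ j) :
    (Fintype.card ι : ℝ) * (Fintype.card ι - 1) * ∑ σ : Equiv.Perm ι, f (σ i) (σ j) =
      (Fintype.card ι).factorial * ∑ k, ∑ l, f k l := by
  obtain ⟨s, hs⟩ : ∃ s, s = ∑ σ : Equiv.Perm ι, f (σ i) (σ j) := ⟨_, rfl⟩
  have hconst : ∀ k l, ∑ σ : Equiv.Perm ι, f (σ k) (σ l) = if k = l then 0 else s := by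
    intro k l
    rw [hs]
    split_ifs with hkl
    · simp [hkl, hf]
    · obtain ⟨τ, hi, hj⟩ := MulAction.is_two_pretransitive_iff.mp
        (Equiv.Perm.isMultiplyPretransitive ι 2) hij hkl
      simp only [Equiv.Perm.smul_def] at hi hj
      rw [← Equiv.sum_comp (Equiv.mulRight τ) (fun σ : Equiv.Perm ι => f (σ i) (σ j))]
      simp [hi, hj]
  have hsum : ∑ k, ∑ l, ∑ σ : Equiv.Perm ι, f (σ k) (σ l) =
      (Fintype.card ι).factorial * ∑ k, ∑ l, f k l := by
    calc _ = ∑ σ : Equiv.Perm ι, ∑ k, ∑ l, f (σ k) (σ l) := by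
          rw [Finset.sum_comm (s := (Finset.univ : Finset (Equiv.Perm ι)))]
          exact Finset.sum_congr rfl fun k _ => Finset.sum_comm
      _ = ∑ σ : Equiv.Perm ι, ∑ k, ∑ l, f k l := by
          refine Finset.sum_congr rfl fun σ _ => ?_
          rw [Equiv.sum_comp σ (fun k => ∑ l, f k (σ l))]
          exact Finset.sum_congr rfl fun k _ => Equiv.sum_comp σ (f k)
      _ = _ := by simp [Fintype.card_perm]
  rw [← hsum, ← hs]
  simp only [hconst]
  have : ∀ k l : ι, (if k = l then (0 : ℝ) else s) = s - if k = l then s else 0 := by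
    intro k l; split_ifs <;> simp
  simp only [this, Finset.sum_sub_distrib, Finset.sum_const, Finset.card_univ, nsmul_eq_mul,
    Finset.sum_ite_eq, Finset.mem_univ, if_true]
  ring

theorem norm_sq_sum_smul_eq {ι E : Type*} [Fintype ι] [NormedAddCommGroup E]
    [InnerProductSpace ℝ E] (w : ι → ℝ) (hw : ∑ i, w i = 1) (y : ι → E) :
    ‖∑ i, w i • y i‖ ^ 2 =
      ∑ i, w i * ‖y i‖ ^ 2 - 1 / 2 * ∑ i, ∑ j, w i * w j * ‖y i - y j‖ ^ 2 := by
  have h1 : ∀ i j, w i * w j * ‖y i - y j‖ ^ 2 =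
      (w i * ‖y i‖ ^ 2) * w j + w i * (w j * ‖y j‖ ^ 2) - 2 * (w i * w j * ⟪y i, y j⟫_ℝ) := by
    intro i j
    rw [@norm_sub_sq_real]; ring
  have h2 : ‖∑ i, w i • y i‖ ^ 2 = ∑ i, ∑ j, w i * w j * ⟪y i, y j⟫_ℝ := by
    rw [← real_inner_self_eq_norm_sq, sum_inner]
    refine Finset.sum_congr rfl fun i _ => ?_
    rw [inner_sum]
    refine Finset.sum_congr rfl fun j _ => ?_
    rw [real_inner_smul_left, real_inner_smul_right, mul_assoc]
  rw [h2]
  simp only [h1, Finset.sum_sub_distrib, Finset.sum_add_distrib, ← Finset.mul_sum,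
    ← Finset.sum_mul, hw]
  ring

/-- AM–GM for the eigenvalues of `AᵀA`, whose product is `(det A)²`. -/
theorem LinearMap.card_mul_abs_det_rpow_le_trace {E : Type*} [NormedAddCommGroup E]
    [InnerProductSpace ℝ E] [FiniteDimensional ℝ E] {d : ℕ} (hd : 1 ≤ d)
    (hE : Module.finrank ℝ E = d) (A : E →ₗ[ℝ] E) :
    d * |LinearMap.det A| ^ (2 / (d : ℝ)) ≤ LinearMap.trace ℝ E (A.adjoint ∘ₗ A) := by
  have hpos := A.isPositive_adjoint_comp_self
  have hev := hpos.nonneg_eigenvalues hE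
  have hdet := hpos.isSymmetric.det_eq_prod_eigenvalues hE
  have htr := hpos.isSymmetric.trace_eq_sum_eigenvalues hE
  have hd' : (d : ℝ) ≠ 0 := by positivity
  have hadj : LinearMap.det A.adjoint = LinearMap.det A := by
    let e := stdOrthonormalBasis ℝ E
    rw [← LinearMap.det_toMatrix e.toBasis, ← LinearMap.det_toMatrix e.toBasis A,
      LinearMap.toMatrix_adjoint, Matrix.conjTranspose_eq_transpose_of_trivial,
      Matrix.det_transpose]
  rw [LinearMap.det_comp, hadj] at hdet
  have hamgm := Real.geom_mean_le_arith_mean_weighted Finset.univ (fun _ : Fin d => 1 / (d : ℝ))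
    (hpos.isSymmetric.eigenvalues hE) (fun _ _ => by positivity) (by simp [hd'])
    (fun i _ => hev i)
  rw [Real.finsetProd_rpow _ _ (fun i _ => hev i), ← Finset.mul_sum] at hamgm
  simp only [RCLike.ofReal_real_eq_id, id_eq] at hdet htr
  rw [← hdet, ← htr, ← abs_mul_abs_self, ← pow_two, ← Real.rpow_natCast,
    ← Real.rpow_mul (abs_nonneg _)] at hamgm
  calc _ = (d : ℝ) * |LinearMap.det A| ^ (((2 : ℕ) : ℝ) * (1 / d)) := by
        congr 2; push_cast; ring
    _ ≤ d * (1 / d * LinearMap.trace ℝ E (A.adjoint ∘ₗ A)) := by gcongr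
    _ = _ := by field_simp

/-! ### The edges of a regular simplex as a tight frame. -/

section Frame

variable {ι E : Type*} [DecidableEq ι] [NormedAddCommGroup E] [InnerProductSpace ℝ E]

/-- Polarization expresses the inner product through four squared distances, each `r²` or `0`. -/
theorem inner_sub_sub_eq_of_equilateral {v : ι → E} {r : ℝ}
    (hv : ∀ i j, i ≠ j → dist (v i) (v j) = r) (k l i j : ι) :
    ⟪v k - v l, v i - v j⟫_ℝ = r ^ 2 / 2 *
      ((if k = i then 1 else 0) + (if l = j then 1 else 0) - (if k = j then 1 else 0)
        - (if l = i then 1 else 0)) := by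
  have hD : ∀ a b, ‖v a - v b‖ ^ 2 = r ^ 2 * (1 - if a = b then 1 else 0) := by
    intro a b
    split_ifs with h
    · simp [h]
    · rw [← dist_eq_norm, hv a b h]; ring
  have hpol : ⟪v k - v l, v i - v j⟫_ℝ =
      (‖v k - v j‖ ^ 2 + ‖v l - v i‖ ^ 2 - ‖v k - v i‖ ^ 2 - ‖v l - v j‖ ^ 2) / 2 := by
    simp only [@norm_sub_sq_real, inner_sub_left, inner_sub_right]
    ring
  rw [hpol, hD, hD, hD, hD]
  ring

variable [Fintype ι]

theorem sum_inner_sub_smul_sub_of_equilateral (b : AffineBasis ι ℝ E) {r : ℝ}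
    (hv : ∀ i j, i ≠ j → dist (b i) (b j) = r) (y : E) :
    ∑ k, ∑ l, ⟪b k - b l, y⟫_ℝ • (b k - b l) = (Fintype.card ι * r ^ 2) • y := by
  obtain ⟨i₀⟩ := b.nonempty
  let K : E →ₗ[ℝ] E := ∑ k, ∑ l, (innerₛₗ ℝ (b k - b l)).smulRight (b k - b l)
  have hK : K = (Fintype.card ι * r ^ 2) • LinearMap.id := by
    -- By linearity it suffices to check the edges issuing from one vertex, which form a basis.
    refine (b.basisOf i₀).ext fun j => ?_
    simp only [K, LinearMap.sum_apply, LinearMap.smulRight_apply, innerₛₗ_apply_apply,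
      AffineBasis.basisOf_apply, vsub_eq_sub, inner_sub_sub_eq_of_equilateral hv,
      LinearMap.smul_apply, LinearMap.id_apply]
    simp only [mul_add, mul_sub, mul_ite, mul_one, mul_zero, add_smul, sub_smul, ite_smul,
      zero_smul, Finset.sum_add_distrib, Finset.sum_sub_distrib, Finset.sum_ite_eq',
      Finset.mem_univ, if_true, smul_sub, Finset.sum_const, Finset.card_univ,
      Finset.sum_ite_irrel, smul_ite, smul_zero, ← Nat.cast_smul_eq_nsmul ℝ]
    module
  have := LinearMap.congr_fun hK y
  simpa only [K, LinearMap.sum_apply, LinearMap.smulRight_apply, innerₛₗ_apply_apply,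
    LinearMap.smul_apply, LinearMap.id_apply] using this

variable [FiniteDimensional ℝ E]

/-- Expand `‖A x‖²` in an orthonormal basis and apply the frame identity to each `Aᵀ e_m`; what
remains is `tr(AAᵀ) = tr(AᵀA)`. -/
theorem sum_norm_sq_map_sub_of_equilateral (b : AffineBasis ι ℝ E) {r : ℝ}
    (hv : ∀ i j, i ≠ j → dist (b i) (b j) = r) (A : E →ₗ[ℝ] E) :
    ∑ k, ∑ l, ‖A (b k - b l)‖ ^ 2 =
      Fintype.card ι * r ^ 2 * LinearMap.trace ℝ E (A.adjoint ∘ₗ A) := by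
  let e := stdOrthonormalBasis ℝ E
  have hparseval : ∀ x : E, ‖A x‖ ^ 2 = ∑ m, ⟪x, A.adjoint (e m)⟫_ℝ * ⟪x, A.adjoint (e m)⟫_ℝ := by
    intro x
    rw [← e.sum_sq_norm_inner_left (A x)]
    refine Finset.sum_congr rfl fun m _ => ?_
    rw [LinearMap.adjoint_inner_right, Real.norm_eq_abs, sq_abs, pow_two]
  have hframe : ∀ y : E, ∑ k, ∑ l, ⟪b k - b l, y⟫_ℝ * ⟪b k - b l, y⟫_ℝ =
      (Fintype.card ι * r ^ 2) * ‖y‖ ^ 2 := by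
    intro y
    have h := congrArg (fun z => ⟪z, y⟫_ℝ) (sum_inner_sub_smul_sub_of_equilateral b hv y)
    simpa [sum_inner, real_inner_smul_left] using h
  simp_rw [hparseval]
  calc _ = ∑ m, ∑ k, ∑ l,
        ⟪b k - b l, A.adjoint (e m)⟫_ℝ * ⟪b k - b l, A.adjoint (e m)⟫_ℝ := by
        rw [Finset.sum_comm (s := (Finset.univ : Finset (Fin (Module.finrank ℝ E))))]
        exact Finset.sum_congr rfl fun k _ => Finset.sum_comm
    _ = Fintype.card ι * r ^ 2 * ∑ m, ‖A.adjoint (e m)‖ ^ 2 := by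
        simp_rw [hframe, Finset.mul_sum]
    _ = _ := by
        congr 1
        rw [LinearMap.trace_comp_comm', LinearMap.trace_eq_sum_inner _ e]
        refine Finset.sum_congr rfl fun m _ => ?_
        rw [LinearMap.comp_apply, ← LinearMap.adjoint_inner_left, real_inner_self_eq_norm_sq]

theorem sum_perm_norm_sq_map_sub_of_equilateral {d : ℕ} (hd : 1 ≤ d)
    (hι : Fintype.card ι = d + 1) (b : AffineBasis ι ℝ E) {r : ℝ}
    (hv : ∀ i j, i ≠ j → dist (b i) (b j) = r) (A : E →ₗ[ℝ] E) (i j : ι) :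
    ∑ σ : Equiv.Perm ι, ‖A (b (σ i) - b (σ j))‖ ^ 2 =
      ((Fintype.card ι).factorial * (LinearMap.trace ℝ E (A.adjoint ∘ₗ A) / d)) * ‖b i - b j‖ ^ 2 := by
  rcases eq_or_ne i j with rfl | hij
  · simp
  have h := Equiv.Perm.sum_apply_pair (fun k l => ‖A (b k - b l)‖ ^ 2) (by simp) hij
  have hd' : (0 : ℝ) < d := by positivity
  simp only [sum_norm_sq_map_sub_of_equilateral b hv] at h
  rw [← dist_eq_norm, hv i j hij]
  have hc : (Fintype.card ι : ℝ) = d + 1 := by simp [hι]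
  rw [hc] at h
  field_simp
  have h1 : (0 : ℝ) < d + 1 := by positivity
  apply mul_left_cancel₀ h1.ne'
  linear_combination h

/-- Averaging a quadratic function over the symmetries of a regular simplex yields, up to an
affine function, a multiple of the squared norm. -/
theorem exists_affine_sum_perm_norm_sq {d : ℕ} (hd : 1 ≤ d)
    (hι : Fintype.card ι = d + 1) (b : AffineBasis ι ℝ E) {r : ℝ}
    (hv : ∀ i j, i ≠ j → dist (b i) (b j) = r) (φ : E →ᵃ[ℝ] E)
    (R : Equiv.Perm ι → E →ᵃ[ℝ] E) (hR : ∀ σ i, R σ (b i) = b (σ i)) :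
    ∃ u : E →ᵃ[ℝ] ℝ, ∀ x, ∑ σ, ‖φ (R σ x)‖ ^ 2 =
      ((Fintype.card ι).factorial * (LinearMap.trace ℝ E (φ.linear.adjoint ∘ₗ φ.linear) / d)) * ‖x‖ ^ 2
        + u x := by
  set c := ((Fintype.card ι).factorial * (LinearMap.trace ℝ E (φ.linear.adjoint ∘ₗ φ.linear) / d))
  have hcoord : ∀ σ x, φ (R σ x) = ∑ i, b.coord i x • φ (b (σ i)) := by
    intro σ x
    have hx := b.affineCombination_coord_eq_self x
    conv_lhs => rw [← hx]
    rw [Finset.map_affineCombination _ _ _ (b.sum_coord_apply_eq_one x),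
      Finset.map_affineCombination _ _ _ (b.sum_coord_apply_eq_one x),
      Finset.affineCombination_eq_linear_combination _ _ _ (b.sum_coord_apply_eq_one x)]
    simp [hR]
  -- The affine function interpolating at the vertices the difference of the two quadratics; the
  -- edge terms cancel by `hpair`.
  refine ⟨∑ i, (∑ σ : Equiv.Perm ι, ‖φ (b (σ i))‖ ^ 2 - c * ‖b i‖ ^ 2) • b.coord i, fun x => ?_⟩
  have hsum := b.sum_coord_apply_eq_one x
  have hx : ‖x‖ ^ 2 = ∑ i, b.coord i x * ‖b i‖ ^ 2 -
      1 / 2 * ∑ i, ∑ j, b.coord i x * b.coord j x * ‖b i - b j‖ ^ 2 := by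
    rw [← norm_sq_sum_smul_eq _ hsum, b.linear_combination_coord_eq_self]
  have hpair : ∑ σ : Equiv.Perm ι, ∑ i, ∑ j,
      b.coord i x * b.coord j x * ‖φ (b (σ i)) - φ (b (σ j))‖ ^ 2 =
      c * ∑ i, ∑ j, b.coord i x * b.coord j x * ‖b i - b j‖ ^ 2 := by
    rw [Finset.sum_comm, Finset.mul_sum]
    refine Finset.sum_congr rfl fun i _ => ?_
    rw [Finset.sum_comm, Finset.mul_sum]
    refine Finset.sum_congr rfl fun j _ => ?_
    have h := sum_perm_norm_sq_map_sub_of_equilateral hd hι b hv φ.linear i j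
    have hlin : ∀ p q : E, φ.linear (p - q) = φ p - φ q := fun p q => φ.linearMap_vsub p q
    simp_rw [hlin] at h
    rw [← Finset.mul_sum, h]
    ring
  have heval : (∑ i, (∑ σ : Equiv.Perm ι, ‖φ (b (σ i))‖ ^ 2 - c * ‖b i‖ ^ 2) • b.coord i) x =
      ∑ i, (∑ σ : Equiv.Perm ι, ‖φ (b (σ i))‖ ^ 2 - c * ‖b i‖ ^ 2) * b.coord i x := by
    have h := map_sum (AddMonoidHom.mk' (fun u : E →ᵃ[ℝ] ℝ => u x) (fun _ _ => rfl))
      (fun i => (∑ σ : Equiv.Perm ι, ‖φ (b (σ i))‖ ^ 2 - c * ‖b i‖ ^ 2) • b.coord i) Finset.univ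
    exact h.trans (Finset.sum_congr rfl fun _ _ => rfl)
  have hterm : ∀ σ, ‖φ (R σ x)‖ ^ 2 = ∑ i, b.coord i x * ‖φ (b (σ i))‖ ^ 2 -
      1 / 2 * ∑ i, ∑ j, b.coord i x * b.coord j x * ‖φ (b (σ i)) - φ (b (σ j))‖ ^ 2 := by
    intro σ
    rw [hcoord, norm_sq_sum_smul_eq _ hsum]
  simp_rw [hterm, Finset.sum_sub_distrib, ← Finset.mul_sum]
  rw [hpair, heval, hx, Finset.sum_comm]
  simp_rw [sub_mul, Finset.sum_sub_distrib, Finset.sum_mul, mul_sub, Finset.mul_sum]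
  have e1 : ∀ i, ∑ σ : Equiv.Perm ι, ‖φ (b (σ i))‖ ^ 2 * b.coord i x =
      ∑ σ : Equiv.Perm ι, b.coord i x * ‖φ (b (σ i))‖ ^ 2 :=
    fun i => Finset.sum_congr rfl fun _ _ => mul_comm _ _
  have e2 : ∑ i, c * ‖b i‖ ^ 2 * b.coord i x = ∑ i, c * (b.coord i x * ‖b i‖ ^ 2) :=
    Finset.sum_congr rfl fun _ _ => by ring
  have e3 : ∀ i j, 1 / 2 * (c * (b.coord i x * b.coord j x * ‖b i - b j‖ ^ 2)) =
      c * (1 / 2 * (b.coord i x * b.coord j x * ‖b i - b j‖ ^ 2)) := fun _ _ => by ring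
  simp_rw [e1, e3]
  rw [e2]
  ring

end Frame

/-! ### Affine changes of variables and the asymmetric norm. -/

theorem coe_affineEquiv_eq_add_comp {E : Type*} [AddCommGroup E] [Module ℝ E] (e : E ≃ᵃ[ℝ] E) :
    (e : E → E) = (fun x => x + e 0) ∘ (e.linear : E →ₗ[ℝ] E) := by
  ext1 x
  simpa using e.map_vadd 0 x

theorem volume_image_affineEquiv {d : ℕ}
    (e : EuclideanSpace ℝ (Fin d) ≃ᵃ[ℝ] EuclideanSpace ℝ (Fin d))
    (G : Set (EuclideanSpace ℝ (Fin d))) :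
    volume (e '' G) = ENNReal.ofReal
      |LinearMap.det (e.linear : EuclideanSpace ℝ (Fin d) →ₗ[ℝ] EuclideanSpace ℝ (Fin d))| *
        volume G := by
  rw [coe_affineEquiv_eq_add_comp, Set.image_comp, Set.image_add_right, measure_preimage_add_right,
    Measure.addHaar_image_linearMap]

section AsymNorm

variable {α β : ℝ}

theorem asymAbs_nonneg (hα : 0 ≤ α) (hβ : 0 ≤ β) (t : ℝ) : 0 ≤ asymAbs α β t := by
  unfold asymAbs; positivity

theorem asymAbs_add_le (hα : 0 ≤ α) (hβ : 0 ≤ β) (s t : ℝ) :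
    asymAbs α β (s + t) ≤ asymAbs α β s + asymAbs α β t := by
  have h1 : max (s + t) 0 ≤ max s 0 + max t 0 := by
    simpa using max_add_add_le_max_add_max (a := s) (b := t) (c := (0 : ℝ)) (d := 0)
  have h2 : max (-(s + t)) 0 ≤ max (-s) 0 + max (-t) 0 := by
    rw [neg_add]
    simpa using max_add_add_le_max_add_max (a := -s) (b := -t) (c := (0 : ℝ)) (d := 0)
  unfold asymAbs
  nlinarith [mul_le_mul_of_nonneg_left h1 hα, mul_le_mul_of_nonneg_left h2 hβ]

theorem asymAbs_sum_le (hα : 0 ≤ α) (hβ : 0 ≤ β) {ι : Type*} (s : Finset ι) (f : ι → ℝ) :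
    asymAbs α β (∑ i ∈ s, f i) ≤ ∑ i ∈ s, asymAbs α β (f i) :=
  Finset.le_sum_of_subadditive _ (by simp [asymAbs]) (asymAbs_add_le hα hβ) s f

theorem asymAbs_mul {c : ℝ} (hc : 0 ≤ c) (t : ℝ) :
    asymAbs α β (c * t) = c * asymAbs α β t := by
  have h1 : max (c * t) 0 = c * max t 0 := by rw [mul_max_of_nonneg _ _ hc, mul_zero]
  have h2 : max (-(c * t)) 0 = c * max (-t) 0 := by
    rw [mul_max_of_nonneg _ _ hc, mul_zero, mul_neg]
  rw [asymAbs, asymAbs, h1, h2]; ring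

theorem continuous_asymAbs : Continuous (asymAbs α β) := by
  unfold asymAbs; fun_prop

variable {d : ℕ} {p : ℝ≥0∞} {G : Set (EuclideanSpace ℝ (Fin d))}

theorem asymNorm_sum_le (hp : 1 ≤ p) (hα : 0 ≤ α) (hβ : 0 ≤ β) {ι : Type*} (s : Finset ι)
    (f : ι → EuclideanSpace ℝ (Fin d) → ℝ) (hf : ∀ i ∈ s, Continuous (f i)) :
    asymNorm p α β G (fun x => ∑ i ∈ s, f i x) ≤ ∑ i ∈ s, asymNorm p α β G (f i) := by
  unfold asymNorm
  refine (eLpNorm_mono_real (g := ∑ i ∈ s, fun x => asymAbs α β (f i x)) fun x => ?_).trans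
    (eLpNorm_sum_le (fun i hi =>
      (continuous_asymAbs.comp (hf i hi)).aestronglyMeasurable) hp)
  rw [Real.norm_of_nonneg (asymAbs_nonneg hα hβ _), Finset.sum_apply]
  exact asymAbs_sum_le hα hβ s _

theorem asymNorm_const_mul {c : ℝ} (hc : 0 ≤ c) (f : EuclideanSpace ℝ (Fin d) → ℝ) :
    asymNorm p α β G (fun x => c * f x) = ENNReal.ofReal c * asymNorm p α β G f := by
  unfold asymNorm
  simp_rw [asymAbs_mul hc]
  rw [← Real.enorm_of_nonneg hc]
  exact eLpNorm_const_smul c _ p _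

theorem asymNorm_comp_affineEquiv
    (e : EuclideanSpace ℝ (Fin d) ≃ᵃ[ℝ] EuclideanSpace ℝ (Fin d))
    {f : EuclideanSpace ℝ (Fin d) → ℝ} (hf : Continuous f) (hG : MeasurableSet (e '' G)) :
    asymNorm p α β (e '' G) f =
      ENNReal.ofReal |LinearMap.det (e.linear : EuclideanSpace ℝ (Fin d) →ₗ[ℝ] _)| ^ p⁻¹.toReal *
        asymNorm p α β G (f ∘ e) := by
  set A : EuclideanSpace ℝ (Fin d) →ₗ[ℝ] EuclideanSpace ℝ (Fin d) := ↑e.linear with hA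
  have hdet : LinearMap.det A ≠ 0 := (LinearEquiv.isUnit_det' e.linear).ne_zero
  have hcont : Continuous e := e.continuous_of_finiteDimensional
  have hmap : Measure.map e volume = ENNReal.ofReal |(LinearMap.det A)⁻¹| • volume := by
    rw [coe_affineEquiv_eq_add_comp, ← Measure.map_map (by fun_prop) (A.continuous_of_finiteDimensional.measurable),
      Measure.map_linearMap_addHaar_eq_smul_addHaar volume hdet, Measure.map_smul,
      map_add_right_eq_self]
  have hvol : volume.restrict (e '' G) =
      ENNReal.ofReal |LinearMap.det A| • Measure.map e (volume.restrict G) := by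
    have h := Measure.restrict_map (μ := volume) hcont.measurable hG
    rw [Set.preimage_image_eq _ e.injective, hmap, Measure.restrict_smul] at h
    rw [← h, smul_smul, ← ENNReal.ofReal_mul (abs_nonneg _), ← abs_mul, mul_inv_cancel₀ hdet]
    simp
  unfold asymNorm
  -- This covers `p = ∞` as well: the exponent is then `0`, and rescaling a measure by a nonzero
  -- factor leaves the essential supremum unchanged.
  rw [hvol, eLpNorm_smul_measure_of_ne_zero (by simpa using hdet), one_div, smul_eq_mul,
    eLpNorm_map_measure (g := fun x => asymAbs α β (f x))
      (continuous_asymAbs.comp hf).aestronglyMeasurable hcont.measurable.aemeasurable]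
  rfl

theorem asymNorm_comp_affineIsometryEquiv
    (e : EuclideanSpace ℝ (Fin d) ≃ᵃⁱ[ℝ] EuclideanSpace ℝ (Fin d))
    {f : EuclideanSpace ℝ (Fin d) → ℝ} (hf : Continuous f) (hG : MeasurableSet G)
    (he : e '' G = G) :
    asymNorm p α β G (f ∘ e) = asymNorm p α β G f := by
  have h := asymNorm_comp_affineEquiv (p := p) (α := α) (β := β) (G := G) e.toAffineEquiv hf
    (by simpa [he] using hG)
  have hdet : |LinearMap.det
      (e.toAffineEquiv.linear : EuclideanSpace ℝ (Fin d) →ₗ[ℝ] EuclideanSpace ℝ (Fin d))| = 1 := by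
    have h1 := e.linearIsometryEquiv.toLinearIsometry.normDet_eq_one
    rw [LinearMap.normDet_eq_norm_det] at h1
    exact h1
  rw [hdet] at h
  simpa [he] using h.symm

end AsymNorm

/-! ### Affine functions and maps between simplices. -/

theorem coe_mem_affineFns {d : ℕ} (u : EuclideanSpace ℝ (Fin d) →ᵃ[ℝ] ℝ) :
    (u : EuclideanSpace ℝ (Fin d) → ℝ) ∈ affineFns d := by
  let ℓ := LinearMap.toContinuousLinearMap u.linear
  refine ⟨(InnerProductSpace.toDual ℝ _).symm ℓ, u 0, ?_⟩
  ext1 x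
  have h1 : u x = u.linear x + u 0 := by simpa using u.map_vadd 0 x
  have h2 : ⟪(InnerProductSpace.toDual ℝ _).symm ℓ, x⟫_ℝ = u.linear x := by
    rw [InnerProductSpace.toDual_symm_apply]; rfl
  rw [h1, ← h2, PiLp.inner_apply]
  simp [mul_comm]

theorem exists_coe_eq_of_mem_affineFns {d : ℕ} {g : EuclideanSpace ℝ (Fin d) → ℝ}
    (hg : g ∈ affineFns d) : ∃ u : EuclideanSpace ℝ (Fin d) →ᵃ[ℝ] ℝ, ⇑u = g := by
  obtain ⟨a, c, rfl⟩ := hg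
  refine ⟨(innerₛₗ ℝ a).toAffineMap + AffineMap.const ℝ _ c, ?_⟩
  ext1 x
  simp [PiLp.inner_apply, mul_comm]

theorem quadQ_eq_norm_sq {d : ℕ} (x : EuclideanSpace ℝ (Fin d)) : quadQ d x = ‖x‖ ^ 2 :=
  (EuclideanSpace.real_norm_sq_eq x).symm

namespace Affine.Simplex

variable {d : ℕ}

/-- The affine basis formed by the vertices of a nondegenerate simplex in `ℝ^d`. -/
noncomputable def vertexBasis (T : Affine.Simplex ℝ (EuclideanSpace ℝ (Fin d)) d) :
    AffineBasis (Fin (d + 1)) ℝ (EuclideanSpace ℝ (Fin d)) where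
  toFun := T.points
  ind' := T.independent
  tot' := by
    rw [T.independent.affineSpan_eq_top_iff_card_eq_finrank_add_one]
    simp

theorem coe_vertexBasis (T : Affine.Simplex ℝ (EuclideanSpace ℝ (Fin d)) d) :
    ⇑T.vertexBasis = T.points := rfl

theorem exists_affineEquiv (T₀ T : Affine.Simplex ℝ (EuclideanSpace ℝ (Fin d)) d) :
    ∃ e : EuclideanSpace ℝ (Fin d) ≃ᵃ[ℝ] EuclideanSpace ℝ (Fin d),
      ∀ i, e (T₀.points i) = T.points i := by
  let A := (T₀.vertexBasis.basisOf 0).equiv (T.vertexBasis.basisOf 0) (Equiv.refl _)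
  refine ⟨AffineEquiv.mk' (fun x => A (x - T₀.points 0) + T.points 0) A (T₀.points 0)
    (by simp), fun i => ?_⟩
  rcases eq_or_ne i 0 with rfl | hi
  · change A (T₀.points 0 - T₀.points 0) + T.points 0 = T.points 0
    simp
  · have h : A (T₀.vertexBasis.basisOf 0 ⟨i, hi⟩) = T.vertexBasis.basisOf 0 ⟨i, hi⟩ :=
      Module.Basis.equiv_apply _ _ _ _
    simp only [AffineBasis.basisOf_apply, coe_vertexBasis, vsub_eq_sub] at h
    change A (T₀.points i - T₀.points 0) + T.points 0 = T.points i
    rw [h, sub_add_cancel]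

theorem image_closedInterior {T₀ T : Affine.Simplex ℝ (EuclideanSpace ℝ (Fin d)) d}
    (e : EuclideanSpace ℝ (Fin d) ≃ᵃ[ℝ] EuclideanSpace ℝ (Fin d)) (σ : Equiv.Perm (Fin (d + 1)))
    (he : ∀ i, e (T₀.points i) = T.points (σ i)) :
    e '' T₀.closedInterior = T.closedInterior := by
  have h : T₀.map (e : _ →ᵃ[ℝ] _) e.injective = T.reindex σ.symm := by
    ext1 i
    exact he i
  have h2 := T₀.closedInterior_map (f := e.toAffineMap) e.injective
  rw [h, closedInterior_reindex] at h2
  exact h2.symm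

end Affine.Simplex

/-! ### Symmetrization and the extremality of the regular simplex. -/

/-- Symmetrization over the isometries of the regular simplex `T₀`. -/
theorem trace_mul_simplexError_le {d : ℕ} (hd : 1 ≤ d) {p : ℝ≥0∞} (hp : 1 ≤ p) {α β : ℝ}
    (hα : 0 ≤ α) (hβ : 0 ≤ β) {T₀ : Affine.Simplex ℝ (EuclideanSpace ℝ (Fin d)) d}
    (hreg : T₀.Regular) (φ : EuclideanSpace ℝ (Fin d) →ᵃ[ℝ] EuclideanSpace ℝ (Fin d))
    (u : EuclideanSpace ℝ (Fin d) →ᵃ[ℝ] ℝ)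
    {A : EuclideanSpace ℝ (Fin d) →ₗ[ℝ] EuclideanSpace ℝ (Fin d)} (hA : φ.linear = A)
    (htr : 0 < LinearMap.trace ℝ _ (A.adjoint ∘ₗ A)) :
    ENNReal.ofReal (LinearMap.trace ℝ _ (A.adjoint ∘ₗ A) / d) * simplexError p α β T₀ ≤
      asymNorm p α β T₀.closedInterior (fun x => quadQ d (φ x) - u x) := by
  subst hA
  set t := LinearMap.trace ℝ _ (φ.linear.adjoint ∘ₗ φ.linear) / d with ht
  have htpos : 0 < t := by positivity
  obtain ⟨r, hr⟩ := hreg.equilateral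
  choose R hR using hreg
  let R' := fun σ => (R σ).toRealAffineIsometryEquiv
  have hR' : ∀ σ i, R' σ (T₀.points i) = T₀.points (σ i) := by
    intro σ i
    simpa [R'] using (congrFun (hR σ) i).symm
  have himg : ∀ σ, R' σ '' T₀.closedInterior = T₀.closedInterior := fun σ =>
    Affine.Simplex.image_closedInterior (R' σ).toAffineEquiv σ (hR' σ)
  obtain ⟨w, hw⟩ := exists_affine_sum_perm_norm_sq hd (by simp) T₀.vertexBasis hr φ
    (fun σ => ((R' σ).toAffineEquiv : _ →ᵃ[ℝ] _)) hR'
  have hucont : Continuous u := u.continuous_of_finiteDimensional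
  have hφcont : Continuous φ := φ.continuous_of_finiteDimensional
  set f : EuclideanSpace ℝ (Fin d) → ℝ := fun x => quadQ d (φ x) - u x with hf
  have hfcont : Continuous f := by
    simp only [hf, quadQ_eq_norm_sq]; fun_prop
  set N : ℝ := ↑(Fintype.card (Fin (d + 1))).factorial with hN
  have hNpos : 0 < N := by positivity
  -- Chosen so that the symmetrized `f` equals `N * t * (Q - v)`; thus `v` competes in the infimum
  -- defining the error on `T₀`.
  let v : EuclideanSpace ℝ (Fin d) →ᵃ[ℝ] ℝ :=
    (N * t)⁻¹ • (∑ σ, u.comp ((R' σ).toAffineEquiv : _ →ᵃ[ℝ] _) - w)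
  have hv : ∀ x, v x = (N * t)⁻¹ * (∑ σ, u (R' σ x) - w x) := by
    intro x
    have h := map_sum (AddMonoidHom.mk' (fun u : EuclideanSpace ℝ (Fin d) →ᵃ[ℝ] ℝ => u x)
      (fun _ _ => rfl)) (fun σ => u.comp ((R' σ).toAffineEquiv : _ →ᵃ[ℝ] _)) Finset.univ
    have h' : (∑ σ, u.comp ((R' σ).toAffineEquiv : _ →ᵃ[ℝ] _)) x = ∑ σ, u (R' σ x) := h
    rw [← h']; rfl
  have hsum : ∀ x, ∑ σ, f (R' σ x) = (N * t) * (quadQ d x - v x) := by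
    intro x
    have h1 := hw x
    simp only [AffineEquiv.coe_toAffineMap, AffineIsometryEquiv.coe_toAffineEquiv] at h1
    simp only [hf, quadQ_eq_norm_sq, Finset.sum_sub_distrib]
    rw [h1, hv, mul_sub (N * t), mul_inv_cancel_left₀ (by positivity)]
    ring
  have hmeas : MeasurableSet T₀.closedInterior := T₀.isClosed_closedInterior.measurableSet
  have hle := asymNorm_sum_le (G := T₀.closedInterior) hp hα hβ Finset.univ
    (fun σ => f ∘ R' σ) (fun σ _ => hfcont.comp (R' σ).continuous)
  simp only [asymNorm_comp_affineIsometryEquiv _ hfcont hmeas (himg _), Function.comp_apply,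
    hsum] at hle
  rw [asymNorm_const_mul (by positivity), ENNReal.ofReal_mul hNpos.le] at hle
  have hcard : ∑ _σ : Equiv.Perm (Fin (d + 1)), asymNorm p α β T₀.closedInterior f =
      ENNReal.ofReal N * asymNorm p α β T₀.closedInterior f := by
    simp [hN, Fintype.card_perm]
  rw [hcard, mul_assoc,
    ENNReal.mul_le_mul_iff_right (by simpa using hNpos) ENNReal.ofReal_ne_top] at hle
  refine le_trans ?_ hle
  gcongr
  exact iInf₂_le _ (coe_mem_affineFns v)

/-- The homogeneous form of the extremality: dividing by the power of the volume bounds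
`simplexSigma`, and setting the volume to `1` bounds `simplexError`. -/
theorem volume_rpow_mul_simplexError_le {d : ℕ} (hd : 1 ≤ d) {p : ℝ≥0∞} (hp : 1 ≤ p) {α β : ℝ}
    (hα : 0 ≤ α) (hβ : 0 ≤ β) {T₀ : Affine.Simplex ℝ (EuclideanSpace ℝ (Fin d)) d}
    (hreg : T₀.Regular) (hvol : volume T₀.closedInterior = 1)
    (T : Affine.Simplex ℝ (EuclideanSpace ℝ (Fin d)) d) :
    0 < volume T.closedInterior ∧ volume T.closedInterior < ∞ ∧
      volume T.closedInterior ^ (2 / (d : ℝ) + p⁻¹.toReal) * simplexError p α β T₀ ≤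
        simplexError p α β T := by
  obtain ⟨e, he⟩ := Affine.Simplex.exists_affineEquiv T₀ T
  have himg : e '' T₀.closedInterior = T.closedInterior :=
    Affine.Simplex.image_closedInterior e (Equiv.refl _) he
  have hmeas : MeasurableSet T.closedInterior := T.isClosed_closedInterior.measurableSet
  set A : EuclideanSpace ℝ (Fin d) →ₗ[ℝ] EuclideanSpace ℝ (Fin d) := ↑e.linear with hA
  have hdet : 0 < |LinearMap.det A| :=
    abs_pos.mpr (LinearEquiv.isUnit_det' e.linear).ne_zero
  have hvolT : volume T.closedInterior = ENNReal.ofReal |LinearMap.det A| := by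
    rw [← himg, volume_image_affineEquiv, hvol, mul_one]
  have hpos : 0 < ENNReal.ofReal |LinearMap.det A| := by simpa using hdet
  have hAM := A.card_mul_abs_det_rpow_le_trace hd (by simp)
  have hd' : (0 : ℝ) < d := by positivity
  have htr : 0 < LinearMap.trace ℝ _ (A.adjoint ∘ₗ A) := lt_of_lt_of_le (by positivity) hAM
  have hscale : ENNReal.ofReal |LinearMap.det A| ^ (2 / (d : ℝ)) ≤
      ENNReal.ofReal (LinearMap.trace ℝ _ (A.adjoint ∘ₗ A) / d) := by
    rw [ENNReal.ofReal_rpow_of_pos hdet]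
    apply ENNReal.ofReal_le_ofReal
    rw [le_div_iff₀ hd']
    linarith
  rw [hvolT]
  refine ⟨hpos, ENNReal.ofReal_lt_top, ?_⟩
  refine le_iInf₂ fun g hg => ?_
  obtain ⟨u, rfl⟩ := exists_coe_eq_of_mem_affineFns hg
  have hucont : Continuous u := u.continuous_of_finiteDimensional
  have hcont : Continuous (fun x : EuclideanSpace ℝ (Fin d) => quadQ d x - u x) := by
    simp only [quadQ_eq_norm_sq]; fun_prop
  rw [← himg, asymNorm_comp_affineEquiv e hcont (by rwa [himg]),
    ENNReal.rpow_add _ _ hpos.ne' ENNReal.ofReal_ne_top,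
    mul_comm (ENNReal.ofReal |LinearMap.det A| ^ (2 / (d : ℝ))), mul_assoc]
  gcongr
  refine (mul_le_mul_left hscale _).trans ?_
  have hlin : e.toAffineMap.linear = A := rfl
  exact trace_mul_simplexError_le hd hp hα hβ hreg e.toAffineMap (u.comp e.toAffineMap) hlin htr

theorem theorem3p1 (d : ℕ) (hd : 1 ≤ d) (p : ℝ≥0∞) (hp : 1 ≤ p)
    (α β : ℝ) (hα : 0 < α) (hβ : 0 < β)
    (T₀ : Affine.Simplex ℝ (EuclideanSpace ℝ (Fin d)) d)
    (hreg : T₀.Regular) (hvol : volume T₀.closedInterior = 1) :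
    sigmaInf d p α β = simplexSigma p α β T₀ ∧
    (⨅ (T : Affine.Simplex ℝ (EuclideanSpace ℝ (Fin d)) d)
        (_ : volume T.closedInterior = 1), simplexError p α β T) = simplexError p α β T₀ := by
  have key := volume_rpow_mul_simplexError_le hd hp hα.le hβ.le hreg hvol
  refine ⟨le_antisymm (iInf_le _ T₀) (le_iInf fun T => ?_),
    le_antisymm (iInf₂_le T₀ hvol) (le_iInf₂ fun T hT => ?_)⟩
  · obtain ⟨hpos, hfin, hle⟩ := key T
    have h0 : simplexSigma p α β T₀ = simplexError p α β T₀ := by simp [simplexSigma, hvol]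
    rw [h0, simplexSigma, ENNReal.le_div_iff_mul_le
      (Or.inl (ENNReal.rpow_pos hpos hfin.ne).ne')
      (Or.inl (ENNReal.rpow_ne_top_of_nonneg (by positivity) hfin.ne)), mul_comm]
    exact hle
  · simpa [hT] using (key T).2.2
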